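/- Let $P$ be a set of $n \ge 3$ points in general position in the Euclidean plane (no three collinear), and let $G$ be a geometric graph with vertex set $P$, that is, a graph whose edges are drawn as straight line segments with both ends in $P$. Three points $u,v,w \in P$ form an empty triangle if no point of $P$ lies in the interior of the triangle $uvw$; an empty triangle $uvw$ is disconnected in $G$ if the subgraph of $G$ induced by $\{u,v,w\}$ is not connected. Let $s(G)$ be the number of disconnected empty triangles. If $s(G) \le n-3$, then $G$ has a plane spanning tree, that is, a subtree containing every vertex of $G$ no two of whose edges intersect except at a common endpoint. Moreover, the bound is tight for every $n \ge 3$: if $u_1, u_2, \dots, u_n$ are the vertices of a regular $n$-gon in cyclic order and $T_n^c$ is the complement of the path $u_1 u_2 \cdots u_n$ in the complete geometric graph on these points, then $s(T_n^c) = n-2$ and $T_n^c$ has no plane spanning tree. -/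

import Mathlib

/-- The Euclidean plane. -/
abbrev Plane : Type := EuclideanSpace ℝ (Fin 2)

/-- The points `p v`, `v : V`, are distinct and no three of them are collinear. -/
def InGeneralPosition {V : Type*} (p : V → Plane) : Prop :=
  Function.Injective p ∧
    ∀ u v w : V, u ≠ v → u ≠ w → v ≠ w → ¬ Collinear ℝ {p u, p v, p w}

/-- Three of the points form an empty triangle if no point of the whole configuration lies in the
interior of the triangle. -/
def IsEmptyTriangle {V : Type*} (p : V → Plane) (t : Finset V) : Prop :=
  t.card = 3 ∧ ∀ q : V, p q ∉ interior (convexHull ℝ (p '' (t : Set V)))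

/-- The number `s(G)` of empty triangles of the point configuration `p` whose three vertices induce
a subgraph of `G` that is not connected. The geometric graph is given by the abstract graph `G` on
the labels `V`, the vertex `v` being drawn at `p v` and the edges as straight segments. -/
noncomputable def numDisconnectedEmptyTriangles {V : Type*} (p : V → Plane)
    (G : SimpleGraph V) : ℕ :=
  Set.ncard {t : Finset V | IsEmptyTriangle p t ∧ ¬ (G.induce (t : Set V)).Connected}

/-- The straight-line drawing of `T` is not self-intersecting: two different edges, drawn as
closed segments, meet in nothing but a common endpoint. -/
def IsPlaneDrawing {V : Type*} (p : V → Plane) (T : SimpleGraph V) : Prop :=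
  ∀ a b c d : V, T.Adj a b → T.Adj c d → s(a, b) ≠ s(c, d) →
    segment ℝ (p a) (p b) ∩ segment ℝ (p c) (p d) ⊆ {p a, p b} ∩ {p c, p d}

/-- `G` contains a non-self-intersecting subtree on all its vertices. -/
def HasPlaneSpanningTree {V : Type*} (p : V → Plane) (G : SimpleGraph V) : Prop :=
  ∃ T : SimpleGraph V, T ≤ G ∧ T.IsTree ∧ IsPlaneDrawing p T

/-- The vertices of a regular `n`-gon, in their cyclic order. -/
noncomputable def regularPolygon (n : ℕ) (k : Fin n) : Plane :=
  !₂[Real.cos (2 * Real.pi * (k : ℕ) / n), Real.sin (2 * Real.pi * (k : ℕ) / n)]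

/-!
The existence half is proved by induction on finite subsets `S` of the points, the triangles being
empty with respect to `S`. Let `D S` be the set of disconnected empty triangles, and suppose
`|D S| + 3 ≤ |S|`. Connected plane subgraphs suffice, since they contain spanning trees.

Three tools are used.
* Plane graphs on two sets that are separated by a line and share a single point of that line have
  a plane union (`PlaneConnects.glue`). In particular a point beyond the line of `b` and `c` can be
  attached to `b` or `c`.
* If `ab` is a hull edge and `c` is the next point around `b`, then `abc` is an empty triangle, `cb`
  is a hull edge of `S \ {a}`, and `a` can be attached to `b` or `c` if `abc` is connected in `G`
  (`IsHullEdge.exists_next`). Repeating this around `b` gives a plane graph on `S` if `b` is a vertex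
  of no disconnected empty triangle (`planeConnects_of_fan`).
* Hence one may assume that every hull edge `ab` is a side of a disconnected empty triangle: else
  attach `a` to a plane graph on `S \ {a}`, which is available by induction if `a` is a vertex of a
  disconnected empty triangle and not needed otherwise (`IsHullEdge.planeConnects_or`).

Sort the points other than an extreme point `x` radially around `x`, and let `y` be the first one
such that `x` and the points up to `y` form a set `B` with `|D B| + 3 ≤ |B|`. The points before `y`
together with `x` form a set `A` with `|D A| + 3 > |A|`, and the points from `y` on together with `x`
form a set `Q`. Some hull edge joins a point before `y` to one from `y` on, and its disconnected
triangle lies neither in `A` nor in `Q`, so `|D A| + |D Q| + 1 ≤ |D S|`. This gives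
`|D Q| + 3 ≤ |Q|`. Now `B` and `Q` lie on different sides of the line `xy` and share `x` and `y`. The
graph on `B` is glued to one on `Q \ {y}` or on `Q \ {x}`, according to whether or not `y` is a
vertex of a triangle of `D Q` (`PlaneConnects.union_of_hullEdge`).

For the regular polygon all triangles are empty, and a triangle is disconnected in the complement of
the path exactly if its vertices are consecutive on the path. A plane spanning tree in the
complement would have a shortest edge `ij`, and every edge at `i + 1` would be shorter or cross it.
-/

/-! ### Signed areas and half-planes -/

/-- Twice the signed area of the triangle `PQR`: positive when `P`, `Q`, `R` is a counterclockwise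
turn, zero when the points are collinear. For fixed `P` and `Q` it is an affine function of `R`
vanishing on the line `PQ`. -/
def orientDet (P Q R : Plane) : ℝ :=
  (Q 0 - P 0) * (R 1 - P 1) - (Q 1 - P 1) * (R 0 - P 0)

theorem orientDet_swap (P Q R : Plane) : orientDet Q P R = -orientDet P Q R := by
  unfold orientDet; ring

theorem orientDet_swap_right (P Q R : Plane) : orientDet P R Q = -orientDet P Q R := by
  unfold orientDet; ring

theorem orientDet_rotate (P Q R : Plane) : orientDet Q R P = orientDet P Q R := by
  unfold orientDet; ring

@[simp] theorem orientDet_left (P Q : Plane) : orientDet P Q P = 0 := by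
  unfold orientDet; ring

@[simp] theorem orientDet_right (P Q : Plane) : orientDet P Q Q = 0 := by
  unfold orientDet; ring

theorem Plane.ext_coord {P Q : Plane} (h0 : P 0 = Q 0) (h1 : P 1 = Q 1) : P = Q := by
  ext i; fin_cases i <;> assumption

theorem sq_dist_coord_pos {P Q : Plane} (h : P ≠ Q) :
    0 < (Q 0 - P 0) ^ 2 + (Q 1 - P 1) ^ 2 := by
  by_contra hn
  apply h
  have h0 : (Q 0 - P 0) ^ 2 = 0 := by nlinarith [sq_nonneg (Q 0 - P 0), sq_nonneg (Q 1 - P 1)]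
  have h1 : (Q 1 - P 1) ^ 2 = 0 := by nlinarith [sq_nonneg (Q 0 - P 0), sq_nonneg (Q 1 - P 1)]
  have h0' := pow_eq_zero_iff (two_ne_zero) |>.1 h0
  have h1' := pow_eq_zero_iff (two_ne_zero) |>.1 h1
  exact Plane.ext_coord (by linarith) (by linarith)

theorem collinear_iff_orientDet_eq_zero (P Q R : Plane) :
    Collinear ℝ {P, Q, R} ↔ orientDet P Q R = 0 := by
  constructor
  · intro h
    rw [collinear_iff_of_mem (p₀ := P) (by simp)] at h
    obtain ⟨v, hv⟩ := h
    obtain ⟨r, hr⟩ := hv Q (by simp)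
    obtain ⟨s, hs⟩ := hv R (by simp)
    subst hr hs
    simp [orientDet]; ring
  · intro h
    by_cases hPQ : P = Q
    · subst hPQ; simpa using collinear_pair ℝ P R
    · have hpos := sq_dist_coord_pos hPQ
      rw [collinear_iff_of_mem (p₀ := P) (by simp)]
      refine ⟨Q - P, ?_⟩
      intro X hX
      simp only [Set.mem_insert_iff, Set.mem_singleton_iff] at hX
      rcases hX with rfl | rfl | rfl
      · exact ⟨0, by simp⟩
      · exact ⟨1, by simp⟩
      · refine ⟨((Q 0 - P 0) * (X 0 - P 0) + (Q 1 - P 1) * (X 1 - P 1)) /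
          ((Q 0 - P 0) ^ 2 + (Q 1 - P 1) ^ 2), ?_⟩
        unfold orientDet at h
        apply Plane.ext_coord
        · simp
          field_simp
          linear_combination (-(Q 1 - P 1)) * h
        · simp
          field_simp
          linear_combination (Q 0 - P 0) * h

theorem orientDet_ne_zero {V : Type*} {p : V → Plane} (hp : InGeneralPosition p) {u v w : V}
    (huv : u ≠ v) (huw : u ≠ w) (hvw : v ≠ w) : orientDet (p u) (p v) (p w) ≠ 0 := fun h =>
  hp.2 u v w huv huw hvw ((collinear_iff_orientDet_eq_zero _ _ _).2 h)

theorem orientDet_combo (P Q C D : Plane) {s t : ℝ} (h : s + t = 1) :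
    orientDet P Q (s • C + t • D) = s * orientDet P Q C + t * orientDet P Q D := by
  obtain rfl : s = 1 - t := by linarith
  simp [orientDet]; ring

theorem mul_orientDet_nonpos_of_mem_convexHull {P Q Z : Plane} {σ : ℝ} {s : Set Plane}
    (hs : ∀ w ∈ s, σ * orientDet P Q w ≤ 0) (hZ : Z ∈ convexHull ℝ s) :
    σ * orientDet P Q Z ≤ 0 := by
  have hc : Convex ℝ {w : Plane | σ * orientDet P Q w ≤ 0} := by
    intro C hC D hD a b ha hb hab
    change σ * orientDet P Q C ≤ 0 at hC
    change σ * orientDet P Q D ≤ 0 at hD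
    change σ * orientDet P Q (a • C + b • D) ≤ 0
    rw [orientDet_combo P Q C D hab]
    nlinarith
  exact convexHull_min hs hc hZ

/-- A point on the other side of a line than the set `s`, or on the line, is not interior to the
convex hull of `s`. -/
theorem notMem_interior_convexHull {P Q Z : Plane} {σ : ℝ} {s : Set Plane} (hPQ : P ≠ Q)
    (hσ : σ ≠ 0) (hs : ∀ w ∈ s, σ * orientDet P Q w ≤ 0) (hZ : 0 ≤ σ * orientDet P Q Z) :
    Z ∉ interior (convexHull ℝ s) := by
  intro hin
  let v : Plane := !₂[-(Q 1 - P 1), Q 0 - P 0]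
  have hcont : Continuous fun ε : ℝ => Z + (ε * σ) • v := by fun_prop
  have hev : ∀ᶠ ε in nhds (0 : ℝ), Z + (ε * σ) • v ∈ interior (convexHull ℝ s) :=
    hcont.continuousAt.eventually_mem (isOpen_interior.mem_nhds (by simpa using hin))
  obtain ⟨ε, hmem, hε⟩ :=
    ((hev.filter_mono nhdsWithin_le_nhds).and (self_mem_nhdsWithin (s := Set.Ioi (0 : ℝ)))).exists
  have h := mul_orientDet_nonpos_of_mem_convexHull hs (interior_subset hmem)
  have hε' : 0 < ε := hε
  have key : σ * orientDet P Q (Z + (ε * σ) • v) = σ * orientDet P Q Z +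
      ε * (σ ^ 2 * ((Q 0 - P 0) ^ 2 + (Q 1 - P 1) ^ 2)) := by
    simp [orientDet, v]; ring
  have := mul_pos hε' (mul_pos (pow_pos (abs_pos.2 hσ) 2) (sq_dist_coord_pos hPQ))
  rw [sq_abs] at this
  linarith

theorem mem_endpoints_of_mem_segment {V : Type*} {p : V → Plane} (hp : InGeneralPosition p)
    {a b v : V} (hab : a ≠ b) (h : p v ∈ segment ℝ (p a) (p b)) : v = a ∨ v = b := by
  by_contra hn
  push Not at hn
  apply orientDet_ne_zero hp hab (Ne.symm hn.1) (Ne.symm hn.2)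
  obtain ⟨s, t, -, -, hst, hz⟩ := h
  rw [← hz, orientDet_combo _ _ _ _ hst]
  simp

/-- Two segments whose endpoints lie strictly on alternate sides of each other's lines cross. -/
theorem exists_mem_segment_inter {A B C D : Plane} (hC : 0 < orientDet A B C)
    (hD : orientDet A B D < 0) (hA : orientDet C D A < 0) (hB : 0 < orientDet C D B) :
    (segment ℝ A B ∩ segment ℝ C D).Nonempty := by
  have hsum : orientDet A B C - orientDet A B D = orientDet C D B - orientDet C D A := by
    unfold orientDet; ring
  have hpos : 0 < orientDet A B C - orientDet A B D := by linarith
  set E := orientDet A B C - orientDet A B D with hE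
  have hne : E ≠ 0 := hpos.ne'
  refine ⟨(orientDet C D B / E) • A + (-orientDet C D A / E) • B, ?_, ?_⟩
  · refine ⟨_, _, by positivity, div_nonneg (by linarith) hpos.le, ?_, rfl⟩
    rw [← add_div, div_eq_one_iff_eq hne]; linarith
  · refine ⟨-orientDet A B D / E, orientDet A B C / E, div_nonneg (by linarith) hpos.le,
      by positivity, ?_, ?_⟩
    · rw [← add_div, div_eq_one_iff_eq hne]; linarith
    · apply Plane.ext_coord <;> simp <;> field_simp <;> unfold orientDet <;> ring

/-- Seen from a point `O` outside the convex hull of the others, the radial order is the order of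
a real-valued function, namely the slope with respect to a coordinate axis `(d₀, d₁)` along which
all of them are in front of `O`. The sign of `σ` selects the direction of rotation. -/
theorem exists_radial_key {V : Type*} (p : V → Plane) (O : Plane) (T : Set V) (d₀ d₁ σ : ℝ)
    (hT : ∀ q ∈ T, 0 < d₀ * (p q 0 - O 0) + d₁ * (p q 1 - O 1)) :
    ∃ θ : V → ℝ, ∀ q ∈ T, ∀ r ∈ T, θ q < θ r ↔ 0 < σ * orientDet O (p q) (p r) := by
  refine ⟨fun q => σ * ((-d₁ * (p q 0 - O 0) + d₀ * (p q 1 - O 1)) /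
    (d₀ * (p q 0 - O 0) + d₁ * (p q 1 - O 1))), fun q hq r hr => ?_⟩
  have hq' := hT q hq
  have hr' := hT r hr
  have hd : 0 < d₀ ^ 2 + d₁ ^ 2 := by
    by_contra hn
    have h0 : d₀ = 0 := by nlinarith [sq_nonneg d₀, sq_nonneg d₁]
    have h1 : d₁ = 0 := by nlinarith [sq_nonneg d₀, sq_nonneg d₁]
    simp [h0, h1] at hq'
  beta_reduce
  unfold orientDet
  generalize p q 0 - O 0 = u₀ at *
  generalize p q 1 - O 1 = u₁ at *
  generalize p r 0 - O 0 = v₀ at *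
  generalize p r 1 - O 1 = v₁ at *
  have key : σ * ((-d₁ * v₀ + d₀ * v₁) / (d₀ * v₀ + d₁ * v₁)) -
      σ * ((-d₁ * u₀ + d₀ * u₁) / (d₀ * u₀ + d₁ * u₁)) =
      σ * (u₀ * v₁ - u₁ * v₀) * ((d₀ ^ 2 + d₁ ^ 2) /
        ((d₀ * u₀ + d₁ * u₁) * (d₀ * v₀ + d₁ * v₁))) := by
    rw [← mul_sub, div_sub_div _ _ hr'.ne' hq'.ne', mul_div_assoc', mul_div_assoc',
      div_eq_div_iff (mul_pos hr' hq').ne' (mul_pos hq' hr').ne']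
    ring
  rw [← sub_pos, key]
  exact mul_pos_iff_of_pos_right (by positivity)

/-! ### Plane connected subgraphs -/

/-- Some plane subgraph of `G` with all its edges inside `S` connects all the points of `S`.
Acyclicity is not required: a spanning tree is extracted at the end. -/
def PlaneConnects {V : Type*} (p : V → Plane) (G : SimpleGraph V) (S : Finset V) : Prop :=
  ∃ T : SimpleGraph V, T ≤ G ∧ (∀ a b, T.Adj a b → a ∈ S ∧ b ∈ S) ∧ IsPlaneDrawing p T ∧
    ∀ u ∈ S, ∀ v ∈ S, T.Reachable u v

theorem planeConnects_pair {V : Type*} [DecidableEq V] (p : V → Plane) {G : SimpleGraph V}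
    {a b : V} (h : G.Adj a b) : PlaneConnects p G {a, b} := by
  have hadj : ∀ u v, (SimpleGraph.edge a b).Adj u v → s(u, v) = s(a, b) := by
    intro u v huv
    rw [SimpleGraph.edge_adj] at huv
    rcases huv.1 with ⟨rfl, rfl⟩ | ⟨rfl, rfl⟩
    · rfl
    · exact Sym2.eq_swap
  have hab : (SimpleGraph.edge a b).Adj a b := by
    rw [SimpleGraph.edge_adj]; exact ⟨Or.inl ⟨rfl, rfl⟩, h.ne⟩
  refine ⟨SimpleGraph.edge a b, ?_, ?_, ?_, ?_⟩
  · intro u v huv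
    rw [SimpleGraph.edge_adj] at huv
    rcases huv.1 with ⟨rfl, rfl⟩ | ⟨rfl, rfl⟩
    · exact h
    · exact h.symm
  · intro u v huv
    rw [SimpleGraph.edge_adj] at huv
    rcases huv.1 with ⟨rfl, rfl⟩ | ⟨rfl, rfl⟩ <;> simp
  · intro u v w z huv hwz hne
    exact absurd ((hadj u v huv).trans (hadj w z hwz).symm) hne
  · intro u hu v hv
    simp only [Finset.mem_insert, Finset.mem_singleton] at hu hv
    rcases hu with rfl | rfl <;> rcases hv with rfl | rfl
    · exact .rfl
    · exact hab.reachable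
    · exact hab.symm.reachable
    · exact .rfl

/-- A segment with both ends on the nonnegative side of a line, where `v` is the only one of the
points on the line itself, meets the other side only in `v`. -/
theorem eq_of_mem_segment_of_nonpos {V : Type*} {p : V → Plane} {S : Finset V} {P Q Z : Plane}
    {σ : ℝ} {v c d : V} (hv : orientDet P Q (p v) = 0)
    (hS : ∀ w ∈ S, w ≠ v → 0 < σ * orientDet P Q (p w)) (hc : c ∈ S) (hd : d ∈ S) (hcd : c ≠ d)
    (hZ : Z ∈ segment ℝ (p c) (p d)) (hneg : σ * orientDet P Q Z ≤ 0) :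
    Z = p v ∧ (v = c ∨ v = d) := by
  obtain ⟨s, t, hs, ht, hst, rfl⟩ := hZ
  rw [orientDet_combo _ _ _ _ hst, mul_add, mul_left_comm, mul_left_comm σ t] at hneg
  by_cases hcv : c = v
  · subst hcv
    have hd' := hS d hd hcd.symm
    rw [hv] at hneg
    have : t = 0 := by
      by_contra h0
      have := mul_pos (lt_of_le_of_ne ht (Ne.symm h0)) hd'
      linarith
    subst this
    obtain rfl : s = 1 := by linarith
    simp
  · have hc' := hS c hc hcv
    by_cases hdv : d = v
    · subst hdv
      rw [hv] at hneg
      have : s = 0 := by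
        by_contra h0
        have := mul_pos (lt_of_le_of_ne hs (Ne.symm h0)) hc'
        linarith
      subst this
      obtain rfl : t = 1 := by linarith
      simp
    · exfalso
      have hd' := hS d hd hdv
      rcases hs.eq_or_lt with rfl | hs'
      · obtain rfl : t = 1 := by linarith
        linarith
      · have := mul_pos hs' hc'
        have := mul_nonneg ht hd'.le
        linarith

/-- Plane graphs on two sets separated by a line that share just one point on that line can be
united. -/
theorem PlaneConnects.glue {V : Type*} [DecidableEq V] {p : V → Plane} {G : SimpleGraph V}
    (hp : InGeneralPosition p) {S₁ S₂ : Finset V} {P Q : Plane} {σ : ℝ} {v : V}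
    (h₁ : PlaneConnects p G S₁) (h₂ : PlaneConnects p G S₂) (hv₁ : v ∈ S₁) (hv₂ : v ∈ S₂)
    (hv : orientDet P Q (p v) = 0) (hS₁ : ∀ w ∈ S₁, σ * orientDet P Q (p w) ≤ 0)
    (hS₂ : ∀ w ∈ S₂, w ≠ v → 0 < σ * orientDet P Q (p w)) :
    PlaneConnects p G (S₁ ∪ S₂) := by
  obtain ⟨T₁, hG₁, hT₁, hpl₁, hr₁⟩ := h₁
  obtain ⟨T₂, hG₂, hT₂, hpl₂, hr₂⟩ := h₂
  have hcross : ∀ a b c d : V, T₁.Adj a b → T₂.Adj c d →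
      segment ℝ (p a) (p b) ∩ segment ℝ (p c) (p d) ⊆ {p a, p b} ∩ {p c, p d} := by
    rintro a b c d hab hcd Z ⟨hZ₁, hZ₂⟩
    have hneg : σ * orientDet P Q Z ≤ 0 := by
      refine mul_orientDet_nonpos_of_mem_convexHull (s := {p a, p b}) ?_ ?_
      · rintro w (rfl | rfl)
        · exact hS₁ _ (hT₁ a b hab).1
        · exact hS₁ _ (hT₁ a b hab).2
      · rwa [convexHull_pair]
    obtain ⟨rfl, hvcd⟩ := eq_of_mem_segment_of_nonpos hv hS₂ (hT₂ c d hcd).1 (hT₂ c d hcd).2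
      hcd.ne hZ₂ hneg
    refine ⟨?_, ?_⟩
    · rcases mem_endpoints_of_mem_segment hp hab.ne hZ₁ with rfl | rfl <;> simp
    · rcases hvcd with rfl | rfl <;> simp
  refine ⟨T₁ ⊔ T₂, sup_le hG₁ hG₂, ?_, ?_, ?_⟩
  · rintro a b (hab | hab)
    · exact ⟨Finset.mem_union_left _ (hT₁ a b hab).1, Finset.mem_union_left _ (hT₁ a b hab).2⟩
    · exact ⟨Finset.mem_union_right _ (hT₂ a b hab).1, Finset.mem_union_right _ (hT₂ a b hab).2⟩
  · rintro a b c d (hab | hab) (hcd | hcd) hne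
    · exact hpl₁ a b c d hab hcd hne
    · exact hcross a b c d hab hcd
    · rw [Set.inter_comm, Set.inter_comm {p a, p b}]
      exact hcross c d a b hcd hab
    · exact hpl₂ a b c d hab hcd hne
  · have hto : ∀ u ∈ S₁ ∪ S₂, (T₁ ⊔ T₂).Reachable u v := by
      intro u hu
      rcases Finset.mem_union.1 hu with hu | hu
      · exact (hr₁ u hu v hv₁).mono le_sup_left
      · exact (hr₂ u hu v hv₂).mono le_sup_right
    exact fun u hu w hw => (hto u hu).trans (hto w hw).symm

theorem PlaneConnects.hasPlaneSpanningTree {V : Type*} [Fintype V] [Nonempty V] {p : V → Plane}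
    {G : SimpleGraph V} (h : PlaneConnects p G Finset.univ) : HasPlaneSpanningTree p G := by
  obtain ⟨T, hTG, -, hpl, hr⟩ := h
  have hconn : T.Connected :=
    { preconnected := fun u v => hr u (Finset.mem_univ u) v (Finset.mem_univ v) }
  obtain ⟨T', hle, htree⟩ := hconn.exists_isTree_le
  exact ⟨T', hle.trans hTG, htree, fun a b c d hab hcd => hpl a b c d (hle hab) (hle hcd)⟩

/-- A point `a` strictly beyond the line of `b` and `c` can be attached to a plane graph on the
near side by an edge to `b` or `c`. -/
theorem PlaneConnects.attach {V : Type*} [DecidableEq V] {p : V → Plane} {G : SimpleGraph V}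
    (hp : InGeneralPosition p) {S : Finset V} {σ : ℝ} {a b c : V} (h : PlaneConnects p G S)
    (hb : b ∈ S) (hc : c ∈ S) (hS : ∀ w ∈ S, σ * orientDet (p b) (p c) (p w) ≤ 0)
    (ha : 0 < σ * orientDet (p b) (p c) (p a)) (hadj : G.Adj a b ∨ G.Adj a c) :
    PlaneConnects p G (insert a S) := by
  have main : ∀ v ∈ S, G.Adj a v → orientDet (p b) (p c) (p v) = 0 →
      PlaneConnects p G (insert a S) := by
    intro v hv hav h0
    have := h.glue hp (planeConnects_pair p hav) hv (by simp) h0 hS (by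
      intro w hw hwv
      simp only [Finset.mem_insert, Finset.mem_singleton] at hw
      rcases hw with rfl | rfl
      · exact ha
      · exact absurd rfl hwv)
    convert this using 1
    ext w
    simp only [Finset.mem_insert, Finset.mem_union, Finset.mem_singleton]
    constructor
    · rintro (h | h) <;> simp [h]
    · rintro (h | h | rfl) <;> simp [*]
  rcases hadj with hadj | hadj
  · exact main b hb hadj (by simp)
  · exact main c hc hadj (by simp)

theorem adj_or_adj_of_induce_connected {V : Type*} [DecidableEq V] {G : SimpleGraph V}
    {a b c : V} (hab : a ≠ b) (h : (G.induce (({a, b, c} : Finset V) : Set V)).Connected) :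
    G.Adj a b ∨ G.Adj a c := by
  have : Nontrivial ↥(({a, b, c} : Finset V) : Set V) :=
    ⟨⟨⟨a, by simp⟩, ⟨b, by simp⟩, by simpa using hab⟩⟩
  obtain ⟨⟨w, hw⟩, hadj⟩ := h.preconnected.exists_adj_of_nontrivial ⟨a, by simp⟩
  have hadj' : G.Adj a w := hadj
  simp only [Finset.coe_insert, Finset.coe_singleton, Set.mem_insert_iff,
    Set.mem_singleton_iff] at hw
  rcases hw with rfl | rfl | rfl
  · exact absurd rfl hadj'.ne
  · exact Or.inl hadj'
  · exact Or.inr hadj'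

theorem planeConnects_triple {V : Type*} [DecidableEq V] {p : V → Plane} {G : SimpleGraph V}
    (hp : InGeneralPosition p) {a b c : V} (hab : a ≠ b) (hac : a ≠ c) (hbc : b ≠ c)
    (h : (G.induce (({a, b, c} : Finset V) : Set V)).Connected) :
    PlaneConnects p G {a, b, c} := by
  have main : ∀ u v w : V, u ≠ v → u ≠ w → v ≠ w → G.Adj v w → (G.Adj u v ∨ G.Adj u w) →
      PlaneConnects p G {u, v, w} := by
    intro u v w huv huw hvw hadj hu
    refine (planeConnects_pair p hadj).attach hp (σ := orientDet (p v) (p w) (p u)) (b := v)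
      (c := w) (by simp) (by simp) ?_ ?_ hu
    · intro z hz
      simp only [Finset.mem_insert, Finset.mem_singleton] at hz
      rcases hz with rfl | rfl <;> simp
    · exact mul_self_pos.2 (orientDet_ne_zero hp hvw huv.symm huw.symm)
  have e1 : ({a, b, c} : Finset V) = {c, a, b} := by ext; simp; tauto
  have e2 : ({a, b, c} : Finset V) = {b, a, c} := by ext; simp; tauto
  rcases adj_or_adj_of_induce_connected hab h with h1 | h1
  · rw [e1] at h ⊢
    exact main c a b hac.symm hbc.symm hab h1
      (adj_or_adj_of_induce_connected hac.symm h)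
  · rw [e2] at h ⊢
    exact main b a c hab.symm hbc hac h1 (adj_or_adj_of_induce_connected hab.symm h)

/-! ### Disconnected empty triangles of a subset -/

open Classical in
/-- The disconnected empty triangles of the points in `S`, where emptiness refers to `S` only. -/
noncomputable def disconnectedTriangles {V : Type*} (p : V → Plane) (G : SimpleGraph V)
    (S : Finset V) : Finset (Finset V) :=
  S.powerset.filter fun t => t.card = 3 ∧
    (∀ q ∈ S, p q ∉ interior (convexHull ℝ (p '' (t : Set V)))) ∧
    ¬ (G.induce (t : Set V)).Connected

theorem mem_disconnectedTriangles {V : Type*} {p : V → Plane} {G : SimpleGraph V} {S t : Finset V} :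
    t ∈ disconnectedTriangles p G S ↔ t ⊆ S ∧ t.card = 3 ∧
      (∀ q ∈ S, p q ∉ interior (convexHull ℝ (p '' (t : Set V)))) ∧
      ¬ (G.induce (t : Set V)).Connected := by
  simp [disconnectedTriangles]

theorem disconnectedTriangles_mono {V : Type*} {p : V → Plane} {G : SimpleGraph V}
    {S' S : Finset V} {P Q : Plane} {σ : ℝ} (hsub : S' ⊆ S) (hPQ : P ≠ Q) (hσ : σ ≠ 0)
    (hS' : ∀ w ∈ S', σ * orientDet P Q (p w) ≤ 0)
    (hS : ∀ w ∈ S, w ∉ S' → 0 ≤ σ * orientDet P Q (p w)) :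
    disconnectedTriangles p G S' ⊆ disconnectedTriangles p G S := by
  intro t ht
  rw [mem_disconnectedTriangles] at ht ⊢
  refine ⟨ht.1.trans hsub, ht.2.1, fun q hq => ?_, ht.2.2.2⟩
  by_cases hq' : q ∈ S'
  · exact ht.2.2.1 q hq'
  · refine notMem_interior_convexHull hPQ hσ ?_ (hS q hq hq')
    rintro _ ⟨w, hw, rfl⟩
    exact hS' w (ht.1 hw)

/-! ### Hull edges -/

/-- The segment `ab` is an edge of the convex hull of `S`: all the other points lie strictly on one
side, which is the left side of `ab` if `σ > 0` and the right side if `σ < 0`. -/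
def IsHullEdge {V : Type*} (p : V → Plane) (S : Finset V) (σ : ℝ) (a b : V) : Prop :=
  a ∈ S ∧ b ∈ S ∧ a ≠ b ∧ ∀ w ∈ S, w ≠ a → w ≠ b → 0 < σ * orientDet (p a) (p b) (p w)

theorem IsHullEdge.symm {V : Type*} {p : V → Plane} {S : Finset V} {σ : ℝ} {a b : V}
    (h : IsHullEdge p S σ a b) : IsHullEdge p S (-σ) b a := by
  refine ⟨h.2.1, h.1, h.2.2.1.symm, fun w hw hwb hwa => ?_⟩
  rw [orientDet_swap, neg_mul_neg]
  exact h.2.2.2 w hw hwa hwb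

/-- Turning the line of a hull edge `ab` around `b` until it meets the next point `c`, one finds
a hull edge `cb` of the points other than `a`, and an empty triangle `abc`. -/
theorem IsHullEdge.exists_next {V : Type*} [DecidableEq V] {p : V → Plane} (G : SimpleGraph V)
    (hp : InGeneralPosition p) {S : Finset V} {σ : ℝ} {a b : V} (hσ : σ ≠ 0)
    (h : IsHullEdge p S σ a b) (hS : 3 ≤ S.card) :
    ∃ c, c ≠ a ∧ IsHullEdge p (S.erase a) σ c b ∧
      disconnectedTriangles p G (S.erase a) ⊆ disconnectedTriangles p G S ∧
      (PlaneConnects p G (S.erase a) → G.Adj a c ∨ G.Adj a b → PlaneConnects p G S) ∧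
      ({a, b, c} ∈ disconnectedTriangles p G S ∨
        (G.induce (({a, b, c} : Finset V) : Set V)).Connected) := by
  obtain ⟨ha, hb, hab, hside⟩ := h
  set R := (S.erase a).erase b with hR
  have hmemR : ∀ {w}, w ∈ R ↔ w ≠ b ∧ w ≠ a ∧ w ∈ S := by simp [hR]
  have hRne : R.Nonempty := by
    rw [← Finset.card_pos, hR, Finset.card_erase_of_mem (by simp [hab.symm, hb]),
      Finset.card_erase_of_mem ha]
    omega
  obtain ⟨θ, hθ⟩ := exists_radial_key p (p b) (R : Set V) (-σ * (p b 1 - p a 1))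
    (σ * (p b 0 - p a 0)) σ (by
      intro q hq
      have hq' := hmemR.1 hq
      have := hside q hq'.2.2 hq'.2.1 hq'.1
      unfold orientDet at this
      linarith)
  obtain ⟨c, hcR, hcmax⟩ := R.exists_max_image θ hRne
  obtain ⟨hcb, hca, hcS⟩ := hmemR.1 hcR
  have hcbw : ∀ w ∈ R, w ≠ c → 0 < σ * orientDet (p c) (p b) (p w) := by
    intro w hw hwc
    obtain ⟨hwb, hwa, hwS⟩ := hmemR.1 hw
    have h1 := (hθ c hcR w hw).not.1 (hcmax w hw).not_gt
    rw [orientDet_swap, mul_neg]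
    have h2 : σ * orientDet (p b) (p c) (p w) ≠ 0 :=
      mul_ne_zero hσ (orientDet_ne_zero hp hcb.symm hwb.symm hwc.symm)
    have := lt_of_le_of_ne (not_lt.1 h1) h2
    linarith
  have hneg : σ * orientDet (p c) (p b) (p a) < 0 := by
    rw [orientDet_swap, orientDet_rotate]
    linarith [hside c hcS hca hcb]
  have hnear : ∀ w ∈ S.erase a, -σ * orientDet (p c) (p b) (p w) ≤ 0 := by
    intro w hw
    by_cases hwb : w = b
    · subst hwb; simp
    by_cases hwc : w = c
    · subst hwc; simp
    · have := hcbw w (hmemR.2 ⟨hwb, Finset.ne_of_mem_erase hw, Finset.mem_of_mem_erase hw⟩) hwc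
      linarith
  have hins : insert a (S.erase a) = S := Finset.insert_erase ha
  refine ⟨c, hca, ⟨by simp [hca, hcS], by simp [hab.symm, hb], hcb, ?_⟩, ?_, ?_, ?_⟩
  · intro w hw hwc hwb
    exact hcbw w (hmemR.2 ⟨hwb, Finset.ne_of_mem_erase hw, Finset.mem_of_mem_erase hw⟩) hwc
  · refine disconnectedTriangles_mono (P := p c) (Q := p b) (Finset.erase_subset _ _)
      (hp.1.ne hcb) (neg_ne_zero.2 hσ) hnear fun w hw hw' => ?_
    obtain rfl : w = a := by
      by_contra hwa
      exact hw' (by simp [hwa, hw])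
    linarith
  · intro hpc hadj
    rw [← hins]
    exact hpc.attach hp (by simp [hca, hcS]) (by simp [hab.symm, hb]) hnear (by linarith) hadj
  · by_cases hconn : (G.induce (({a, b, c} : Finset V) : Set V)).Connected
    · exact Or.inr hconn
    refine Or.inl (mem_disconnectedTriangles.2 ⟨?_, ?_, fun q hq => ?_, hconn⟩)
    · intro w hw
      simp only [Finset.mem_insert, Finset.mem_singleton] at hw
      rcases hw with rfl | rfl | rfl <;> assumption
    · exact Finset.card_eq_three.2 ⟨a, b, c, hab, hca.symm, hcb.symm, rfl⟩
    · by_cases hqa : q = a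
      · -- the line `ab` supports the triangle at `a`
        subst hqa
        refine notMem_interior_convexHull (P := p q) (Q := p b) (σ := -σ) (hp.1.ne hab)
          (neg_ne_zero.2 hσ) ?_ (by simp)
        rintro _ ⟨w, hw, rfl⟩
        simp only [Finset.coe_insert, Finset.coe_singleton, Set.mem_insert_iff,
          Set.mem_singleton_iff] at hw
        rcases hw with rfl | rfl | rfl
        · simp
        · simp
        · have := hside w hcS hca hcb
          linarith
      · -- the line `cb` separates the triangle from the points other than `a`
        refine notMem_interior_convexHull (P := p c) (Q := p b) (σ := σ) (hp.1.ne hcb)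
          hσ ?_ ?_
        · rintro _ ⟨w, hw, rfl⟩
          simp only [Finset.coe_insert, Finset.coe_singleton, Set.mem_insert_iff,
            Set.mem_singleton_iff] at hw
          rcases hw with rfl | rfl | rfl
          · exact hneg.le
          · simp
          · simp
        · have := hnear q (by simp [hqa, hq])
          linarith

/-- If no disconnected empty triangle has the hull vertex `b` as a vertex, then a plane spanning
tree is found by adding the points one by one in the radial order around `b`. -/
theorem planeConnects_of_fan {V : Type*} [DecidableEq V] {p : V → Plane} {G : SimpleGraph V}
    (hp : InGeneralPosition p) {σ : ℝ} {b : V} (hσ : σ ≠ 0) (S : Finset V) (a : V)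
    (h : IsHullEdge p S σ a b) (hS : 3 ≤ S.card)
    (hb : ∀ t ∈ disconnectedTriangles p G S, b ∉ t) : PlaneConnects p G S := by
  obtain ⟨c, hca, hedge, hmono, hattach, htri⟩ := h.exists_next G hp hσ hS
  have ha := h.1
  have hconn := htri.resolve_left fun hmem => hb _ hmem (by simp)
  have hcard := Finset.card_erase_of_mem ha
  rcases hS.eq_or_lt with hS3 | hS4
  · have hsub : ({a, b, c} : Finset V) ⊆ S := by
      intro w hw
      simp only [Finset.mem_insert, Finset.mem_singleton] at hw
      rcases hw with rfl | rfl | rfl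
      · exact ha
      · exact h.2.1
      · exact Finset.mem_of_mem_erase hedge.1
    have hc3 : ({a, b, c} : Finset V).card = 3 :=
      Finset.card_eq_three.2 ⟨a, b, c, h.2.2.1, hca.symm, hedge.2.2.1.symm, rfl⟩
    rw [← Finset.eq_of_subset_of_card_le hsub (by omega)]
    exact planeConnects_triple hp h.2.2.1 hca.symm hedge.2.2.1.symm hconn
  · exact hattach (planeConnects_of_fan hp hσ (S.erase a) c hedge (by omega)
      fun t ht => hb t (hmono ht)) (adj_or_adj_of_induce_connected h.2.2.1 hconn).symm
termination_by S.card
decreasing_by exact Finset.card_erase_lt_of_mem ha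

/-- Removing a point `a` that is a vertex of a disconnected empty triangle of `S` destroys it. -/
theorem card_disconnectedTriangles_erase_lt {V : Type*} [DecidableEq V] {p : V → Plane}
    {G : SimpleGraph V} {S t : Finset V} {a : V}
    (hmono : disconnectedTriangles p G (S.erase a) ⊆ disconnectedTriangles p G S)
    (ht : t ∈ disconnectedTriangles p G S) (hat : a ∈ t) :
    (disconnectedTriangles p G (S.erase a)).card < (disconnectedTriangles p G S).card :=
  Finset.card_lt_card ⟨hmono, fun h =>
    Finset.notMem_erase a S ((mem_disconnectedTriangles.1 (h ht)).1 hat)⟩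

/-- In a minimal counterexample each hull edge is a side of a disconnected empty triangle. -/
theorem IsHullEdge.planeConnects_or {V : Type*} [DecidableEq V] {p : V → Plane}
    {G : SimpleGraph V} (hp : InGeneralPosition p) {S : Finset V} {σ : ℝ} {a b : V} (hσ : σ ≠ 0)
    (h : IsHullEdge p S σ a b) (hS : 3 ≤ S.card)
    (hD : (disconnectedTriangles p G S).card + 3 ≤ S.card)
    (ih : ∀ S' : Finset V, S'.card < S.card → 3 ≤ S'.card →
      (disconnectedTriangles p G S').card + 3 ≤ S'.card → PlaneConnects p G S') :
    PlaneConnects p G S ∨ ∃ t ∈ disconnectedTriangles p G S, a ∈ t ∧ b ∈ t := by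
  obtain ⟨c, hca, hedge, hmono, hattach, htri⟩ := h.exists_next G hp hσ hS
  rcases htri with htri | hconn
  · exact Or.inr ⟨_, htri, by simp, by simp⟩
  left
  by_cases hat : ∃ t ∈ disconnectedTriangles p G S, a ∈ t
  · obtain ⟨t, ht, hat⟩ := hat
    have hlt := card_disconnectedTriangles_erase_lt hmono ht hat
    have hcard := Finset.card_erase_of_mem h.1
    exact hattach (ih _ (by omega) (by omega) (by omega))
      (adj_or_adj_of_induce_connected h.2.2.1 hconn).symm
  · push Not at hat
    exact planeConnects_of_fan hp (neg_ne_zero.2 hσ) S b h.symm hS hat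

/-- If two sets are separated by a line `OD`, then some segment between them has all their points
on its left, namely the one that crosses the line farthest in the direction from `O` to `D`. The
quotient maximized in the proof is the position of the crossing point on the line. -/
theorem exists_bridge {V : Type*} {p : V → Plane} {A B : Finset V} {O D : Plane}
    (hA : A.Nonempty) (hB : B.Nonempty) (hAD : ∀ a ∈ A, orientDet O D (p a) < 0)
    (hBD : ∀ b ∈ B, 0 < orientDet O D (p b)) :
    ∃ a ∈ A, ∃ b ∈ B, (∀ q ∈ A, 0 ≤ orientDet (p a) (p b) (p q)) ∧
      (∀ q ∈ B, 0 ≤ orientDet (p a) (p b) (p q)) := by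
  obtain ⟨⟨a, b⟩, hab, hmax⟩ := (A ×ˢ B).exists_max_image
    (fun x => orientDet O (p x.1) (p x.2) / (orientDet O D (p x.2) - orientDet O D (p x.1)))
    (hA.product hB)
  obtain ⟨ha, hb⟩ := Finset.mem_product.1 hab
  dsimp only at ha hb
  refine ⟨a, ha, b, hb, fun q hq => ?_, fun q hq => ?_⟩
  · have h := hmax (q, b) (Finset.mem_product.2 ⟨hq, hb⟩)
    dsimp only at h
    have h1 := hAD a ha
    have h2 := hAD q hq
    have h3 := hBD b hb
    rw [div_le_div_iff₀ (by linarith) (by linarith)] at h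
    have key : orientDet O (p a) (p b) * (orientDet O D (p b) - orientDet O D (p q)) -
        orientDet O (p q) (p b) * (orientDet O D (p b) - orientDet O D (p a)) =
        orientDet O D (p b) * orientDet (p a) (p b) (p q) := by
      unfold orientDet; ring
    exact nonneg_of_mul_nonneg_right (by linarith) h3
  · have h := hmax (a, q) (Finset.mem_product.2 ⟨ha, hq⟩)
    dsimp only at h
    have h1 := hAD a ha
    have h2 := hBD q hq
    have h3 := hBD b hb
    rw [div_le_div_iff₀ (by linarith) (by linarith)] at h
    have key : orientDet O (p a) (p b) * (orientDet O D (p q) - orientDet O D (p a)) -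
        orientDet O (p a) (p q) * (orientDet O D (p b) - orientDet O D (p a)) =
        -orientDet O D (p a) * orientDet (p a) (p b) (p q) := by
      unfold orientDet; ring
    exact nonneg_of_mul_nonneg_right (by linarith) (neg_pos.2 h1)

/-! ### Existence of a plane spanning tree -/

/-- Some point has a linear radial order of the others around it: a point farthest from the origin
is extreme. -/
theorem exists_extreme_point_radial_key {V : Type*} [DecidableEq V] {p : V → Plane}
    (hp : InGeneralPosition p) {S : Finset V} (hS : S.Nonempty) :
    ∃ x ∈ S, ∃ θ : V → ℝ, ∀ q ∈ S.erase x, ∀ r ∈ S.erase x,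
      θ q < θ r ↔ 0 < orientDet (p x) (p q) (p r) := by
  obtain ⟨x, hx, hmax⟩ := S.exists_max_image (fun q => p q 0 ^ 2 + p q 1 ^ 2) hS
  obtain ⟨θ, hθ⟩ := exists_radial_key p (p x) (S.erase x : Finset V) (-p x 0) (-p x 1) 1 (by
    intro q hq
    have hq' := Finset.mem_erase.1 (Finset.mem_coe.1 hq)
    have h1 := hmax q hq'.2
    have h2 := sq_dist_coord_pos (hp.1.ne hq'.1)
    dsimp only at h1
    nlinarith)
  exact ⟨x, hx, θ, fun q hq r hr => by simpa using hθ q hq r hr⟩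

/-- A plane graph on the right side of the segment `xy` extends to a set `Q` with hull edge `xy` on
the left side, provided that the existence theorem holds for `Q` and for smaller sets. As `x` and
`y` are shared, one of them has to be left out of `Q`: it is `y` if this destroys a disconnected
triangle, so that the counting hypothesis survives; otherwise the points of `Q` other than `x` are
connected radially around `y`. -/
theorem PlaneConnects.union_of_hullEdge {V : Type*} [DecidableEq V] {p : V → Plane}
    {G : SimpleGraph V} (hp : InGeneralPosition p) {B Q : Finset V} {x y : V}
    (hB : PlaneConnects p G B) (hxy : IsHullEdge p Q 1 x y) (hxB : x ∈ B) (hyB : y ∈ B)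
    (hright : ∀ w ∈ B, 1 * orientDet (p x) (p y) (p w) ≤ 0)
    (hD : (disconnectedTriangles p G Q).card + 3 ≤ Q.card)
    (ih : ∀ S' : Finset V, S'.card < Q.card → 3 ≤ S'.card →
      (disconnectedTriangles p G S').card + 3 ≤ S'.card → PlaneConnects p G S') :
    PlaneConnects p G (B ∪ Q) := by
  have hunion : ∀ R : Finset V, R ⊆ Q → (∀ w ∈ Q, w ≠ x → w ≠ y → w ∈ R) → B ∪ R = B ∪ Q := by
    intro R hRQ hR
    refine subset_antisymm (Finset.union_subset_union_right hRQ) fun w hw => ?_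
    rw [Finset.mem_union] at hw ⊢
    by_cases hwx : w = x
    · exact Or.inl (hwx ▸ hxB)
    by_cases hwy : w = y
    · exact Or.inl (hwy ▸ hyB)
    exact hw.imp_right fun h => hR w h hwx hwy
  obtain ⟨hxQ, hyQ, hne, hleft⟩ := id hxy
  by_cases hyt : ∃ t ∈ disconnectedTriangles p G Q, y ∈ t
  · obtain ⟨t, ht, hyt⟩ := hyt
    obtain ⟨-, -, -, hmono, -, -⟩ := hxy.symm.exists_next G hp (by norm_num) (by omega)
    have hlt := card_disconnectedTriangles_erase_lt hmono ht hyt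
    have hcard := Finset.card_erase_of_mem hyQ
    have hpc : PlaneConnects p G (Q.erase y) := ih _ (by omega) (by omega) (by omega)
    rw [← hunion _ (Finset.erase_subset y Q) fun w hw _ hwy => Finset.mem_erase.2 ⟨hwy, hw⟩]
    exact hB.glue hp hpc hxB (Finset.mem_erase.2 ⟨hne, hxQ⟩) (orientDet_left _ _) hright
      fun w hw hwx => hleft w (Finset.mem_of_mem_erase hw) hwx (Finset.ne_of_mem_erase hw)
  · push Not at hyt
    obtain ⟨c, hcx, hcy, hmono, -, htri⟩ := hxy.exists_next G hp one_ne_zero (by omega)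
    have hcard := Finset.card_erase_of_mem hxQ
    rcases (by omega : Q.card = 3 ∨ 4 ≤ Q.card) with hQ3 | hQ4
    · have hconn := htri.resolve_left fun h => hyt _ h (by simp)
      have hcQ := Finset.mem_of_mem_erase hcy.1
      have hsub : ({x, y, c} : Finset V) ⊆ Q := by
        intro w hw
        simp only [Finset.mem_insert, Finset.mem_singleton] at hw
        rcases hw with rfl | rfl | rfl <;> assumption
      have hc3 : ({x, y, c} : Finset V).card = 3 :=
        Finset.card_eq_three.2 ⟨x, y, c, hne, hcx.symm, hcy.2.2.1.symm, rfl⟩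
      have hQeq := Finset.eq_of_subset_of_card_le hsub (by omega)
      have hperm : ({x, y, c} : Finset V) = {c, x, y} := by ext; simp; tauto
      rw [hperm] at hconn
      have := hB.attach hp hxB hyB hright (hleft c hcQ hcx hcy.2.2.1)
        (adj_or_adj_of_induce_connected hcx hconn)
      rwa [Finset.insert_eq, Finset.union_comm, hunion _ (by simpa using hcQ)] at this
      intro w hw hwx hwy
      rw [← hQeq] at hw
      simpa [hwx, hwy] using hw
    · have hpc : PlaneConnects p G (Q.erase x) :=
        planeConnects_of_fan hp one_ne_zero _ c hcy (by omega) fun t ht => hyt t (hmono ht)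
      rw [← hunion _ (Finset.erase_subset x Q) fun w hw hwx _ => Finset.mem_erase.2 ⟨hwx, hw⟩]
      exact hB.glue hp hpc hyB hcy.2.1 (orientDet_right _ _) hright
        fun w hw hwy => hleft w (Finset.mem_of_mem_erase hw) (Finset.ne_of_mem_erase hw) hwy

/-- The existence half of the theorem, for all subsets of the point configuration. -/
theorem planeConnects_of_card_disconnectedTriangles_le {V : Type*} [DecidableEq V]
    {p : V → Plane} {G : SimpleGraph V} (hp : InGeneralPosition p) (S : Finset V)
    (hS : 3 ≤ S.card) (hD : (disconnectedTriangles p G S).card + 3 ≤ S.card) :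
    PlaneConnects p G S := by
  induction hn : S.card using Nat.strong_induction_on generalizing S with
  | _ n ih' =>
  subst hn
  have ih : ∀ S' : Finset V, S'.card < S.card → 3 ≤ S'.card →
      (disconnectedTriangles p G S').card + 3 ≤ S'.card → PlaneConnects p G S' :=
    fun S' hlt h3 hD' => ih' _ hlt S' h3 hD' rfl
  clear ih'
  obtain ⟨x, hx, θ, hθ⟩ :=
    exists_extreme_point_radial_key hp (Finset.card_pos.1 (by omega : 0 < S.card))
  set T := S.erase x with hT
  have hTS : ∀ {q}, q ∈ T → q ∈ S := fun h => Finset.mem_of_mem_erase h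
  have hTx : ∀ {q}, q ∈ T → q ≠ x := fun h => Finset.ne_of_mem_erase h
  have hxT : x ∉ T := Finset.notMem_erase x S
  have hinsT : insert x T = S := Finset.insert_erase hx
  have hpos : ∀ q ∈ T, ∀ r ∈ T, q ≠ r → θ q ≤ θ r → 0 < orientDet (p x) (p q) (p r) := by
    intro q hq r hr hqr hle
    have h1 := (hθ r hr q hq).not.1 hle.not_gt
    have h2 := orientDet_swap_right (p x) (p q) (p r)
    have h3 := orientDet_ne_zero hp (hTx hq).symm (hTx hr).symm hqr
    exact lt_of_le_of_ne (by linarith) h3.symm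
  have hneg : ∀ q ∈ T, ∀ r ∈ T, q ≠ r → θ q ≤ θ r → orientDet (p x) (p r) (p q) < 0 := by
    intro q hq r hr hqr hle
    linarith [hpos q hq r hr hqr hle, orientDet_swap_right (p x) (p q) (p r)]
  -- `y` is the first point for which the points up to `y` satisfy the counting hypothesis
  let lo : V → Finset V := fun y => insert x (T.filter fun q => θ q ≤ θ y)
  have hTne : T.Nonempty := by
    rw [← Finset.card_pos, hT, Finset.card_erase_of_mem hx]; omega
  obtain ⟨y, hyT', hymin⟩ := (T.filter fun y =>
      (disconnectedTriangles p G (lo y)).card + 3 ≤ (lo y).card).exists_min_image θ (by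
    obtain ⟨m, hm, hmmax⟩ := T.exists_max_image θ hTne
    have : lo m = S := by
      simp only [lo]
      rw [Finset.filter_true_of_mem hmmax, hinsT]
    exact ⟨m, Finset.mem_filter.2 ⟨hm, by rw [this]; exact hD⟩⟩)
  obtain ⟨hyT, hy⟩ := Finset.mem_filter.1 hyT'
  set L := T.filter fun q => θ q < θ y with hL
  set U := T.filter fun q => θ y ≤ θ q with hU
  have hmemL : ∀ {q}, q ∈ L ↔ q ∈ T ∧ θ q < θ y := by simp [hL]
  have hmemU : ∀ {q}, q ∈ U ↔ q ∈ T ∧ θ y ≤ θ q := by simp [hU]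
  have hyU : y ∈ U := hmemU.2 ⟨hyT, le_rfl⟩
  have hyL : y ∉ L := fun h => lt_irrefl _ (hmemL.1 h).2
  have hxL : x ∉ L := fun h => hxT (hmemL.1 h).1
  have hxU : x ∉ U := fun h => hxT (hmemU.1 h).1
  have hLU : Disjoint L U := by
    rw [Finset.disjoint_left]
    intro q hq hq'
    exact absurd (hmemL.1 hq).2 (not_lt.2 (hmemU.1 hq').2)
  have hLUT : ∀ {q}, q ∈ T → q ∈ L ∨ q ∈ U := by
    intro q hq
    rcases lt_or_ge (θ q) (θ y) with h | h
    · exact Or.inl (hmemL.2 ⟨hq, h⟩)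
    · exact Or.inr (hmemU.2 ⟨hq, h⟩)
  have hS_cases : ∀ {q}, q ∈ S → q = x ∨ q ∈ L ∨ q ∈ U := by
    intro q hq
    by_cases hqx : q = x
    · exact Or.inl hqx
    · exact Or.inr (hLUT (Finset.mem_erase.2 ⟨hqx, hq⟩))
  have hloy : lo y = insert y (insert x L) := by
    ext q
    simp only [lo, Finset.mem_insert, Finset.mem_filter, hmemL]
    constructor
    · rintro (h | ⟨h1, h2⟩)
      · exact Or.inr (Or.inl h)
      · by_cases hqy : q = y
        · exact Or.inl hqy
        · exact Or.inr (Or.inr ⟨h1, (hθ q h1 y hyT).2 (hpos q h1 y hyT hqy h2)⟩)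
    · rintro (rfl | h | ⟨h1, h2⟩)
      · exact Or.inr ⟨hyT, le_rfl⟩
      · exact Or.inl h
      · exact Or.inr ⟨h1, h2.le⟩
  have hyxL : y ∉ insert x L := by simp [hTx hyT, hyL]
  have hcardlo : (lo y).card = L.card + 2 := by
    rw [hloy, Finset.card_insert_of_notMem hyxL, Finset.card_insert_of_notMem hxL]
  have hLne : L.Nonempty := by rw [← Finset.card_pos]; omega
  obtain ⟨z, hzL, hzmax⟩ := L.exists_max_image θ hLne
  obtain ⟨hzT, hzy⟩ := hmemL.1 hzL
  have hloz : lo z = insert x L := by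
    ext q
    simp only [lo, Finset.mem_insert, Finset.mem_filter, hmemL]
    constructor
    · rintro (h | ⟨h1, h2⟩)
      · exact Or.inl h
      · exact Or.inr ⟨h1, h2.trans_lt hzy⟩
    · rintro (h | h)
      · exact Or.inl h
      · exact Or.inr ⟨h.1, hzmax q (hmemL.2 h)⟩
  set A := insert x L with hA
  set Q := insert x U with hQ
  have hDA : A.card < (disconnectedTriangles p G A).card + 3 := by
    by_contra hcon
    have := hymin z (Finset.mem_filter.2 ⟨hzT, by rw [hloz]; omega⟩)
    linarith
  have hcardA : A.card = L.card + 1 := Finset.card_insert_of_notMem hxL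
  have hcardQ : Q.card = U.card + 1 := Finset.card_insert_of_notMem hxU
  have hcardT : L.card + U.card + 1 = S.card := by
    rw [← Finset.card_union_of_disjoint hLU, ← hinsT, Finset.card_insert_of_notMem hxT]
    congr 2
    ext q
    rw [Finset.mem_union]
    exact ⟨fun h => h.elim (fun h => (hmemL.1 h).1) fun h => (hmemU.1 h).1, hLUT⟩
  -- the line from `x` to `D`, the direction halfway between `z` and `y`, separates `L` from `U`
  obtain ⟨D, hDdef⟩ : ∃ D, D = p z + p y - p x := ⟨_, rfl⟩
  have hDq : ∀ q, orientDet (p x) D (p q) =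
      orientDet (p x) (p z) (p q) + orientDet (p x) (p y) (p q) := by
    intro q
    subst hDdef
    simp [orientDet]; ring
  have hDL : ∀ q ∈ L, orientDet (p x) D (p q) < 0 := by
    intro q hq
    have hq' := hmemL.1 hq
    have h1 := hneg q hq'.1 y hyT (fun h => hyL (h ▸ hq)) hq'.2.le
    rw [hDq]
    by_cases hqz : q = z
    · subst hqz; simpa using h1
    · linarith [hneg q hq'.1 z hzT hqz (hzmax q hq)]
  have hDU : ∀ q ∈ U, 0 < orientDet (p x) D (p q) := by
    intro q hq
    have hq' := hmemU.1 hq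
    have h1 := hpos z hzT q hq'.1 (fun h => (Finset.disjoint_left.1 hLU hzL) (h ▸ hq))
      (hzy.le.trans hq'.2)
    rw [hDq]
    by_cases hqy : y = q
    · subst hqy; simpa using h1
    · linarith [hpos y hyT q hq'.1 hqy hq'.2]
  have hxD : p x ≠ D := by
    rintro h
    have := hDU y hyU
    rw [← h] at this
    simp [orientDet] at this
  have hAS : A ⊆ S := by
    rw [hA, ← hinsT]
    exact Finset.insert_subset_insert _ (Finset.filter_subset _ _)
  have hQS : Q ⊆ S := by
    rw [hQ, ← hinsT]
    exact Finset.insert_subset_insert _ (Finset.filter_subset _ _)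
  have hmonoA : disconnectedTriangles p G A ⊆ disconnectedTriangles p G S := by
    refine disconnectedTriangles_mono (σ := 1) hAS hxD one_ne_zero ?_ ?_
    · intro w hw
      rcases Finset.mem_insert.1 hw with rfl | hw
      · simp
      · simpa using (hDL w hw).le
    · intro w hw hwA
      rcases hS_cases hw with rfl | hw | hw
      · exact absurd (Finset.mem_insert_self _ _) hwA
      · exact absurd (Finset.mem_insert_of_mem hw) hwA
      · simpa using (hDU w hw).le
  have hmonoQ : disconnectedTriangles p G Q ⊆ disconnectedTriangles p G S := by
    refine disconnectedTriangles_mono (σ := -1) hQS hxD (by norm_num) ?_ ?_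
    · intro w hw
      rcases Finset.mem_insert.1 hw with rfl | hw
      · simp
      · simpa using (hDU w hw).le
    · intro w hw hwQ
      rcases hS_cases hw with rfl | hw | hw
      · exact absurd (Finset.mem_insert_self _ _) hwQ
      · simpa using (hDL w hw).le
      · exact absurd (Finset.mem_insert_of_mem hw) hwQ
  -- a hull edge from `L` to `U`
  obtain ⟨a, ha, b, hb, hbrL, hbrU⟩ := exists_bridge hLne ⟨y, hyU⟩ hDL hDU
  have hab : a ≠ b := fun h => Finset.disjoint_left.1 hLU ha (h ▸ hb)
  have haT := (hmemL.1 ha).1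
  have hbT := (hmemU.1 hb).1
  have hedge : IsHullEdge p S 1 a b := by
    refine ⟨hTS haT, hTS hbT, hab, fun w hw hwa hwb => ?_⟩
    rw [one_mul]
    have hne := orientDet_ne_zero hp hab hwa.symm hwb.symm
    rcases hS_cases hw with rfl | hw | hw
    · rw [orientDet_rotate]
      exact hpos a haT b hbT hab ((hmemL.1 ha).2.le.trans (hmemU.1 hb).2)
    · exact lt_of_le_of_ne (hbrL w hw) hne.symm
    · exact lt_of_le_of_ne (hbrU w hw) hne.symm
  rcases hedge.planeConnects_or hp one_ne_zero hS hD ih with hdone | ⟨t, htD, hat, hbt⟩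
  · exact hdone
  -- its triangle belongs neither to `A` nor to `Q`, hence the bound for `Q`
  have htA : t ∉ disconnectedTriangles p G A := by
    intro h
    rcases Finset.mem_insert.1 ((mem_disconnectedTriangles.1 h).1 hbt) with h | h
    · exact hTx hbT h
    · exact Finset.disjoint_left.1 hLU h hb
  have htQ : t ∉ disconnectedTriangles p G Q := by
    intro h
    rcases Finset.mem_insert.1 ((mem_disconnectedTriangles.1 h).1 hat) with h | h
    · exact hTx haT h
    · exact Finset.disjoint_left.1 hLU ha h
  have hdisj : Disjoint (disconnectedTriangles p G A) (disconnectedTriangles p G Q) := by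
    rw [Finset.disjoint_left]
    intro s hsA hsQ
    rw [mem_disconnectedTriangles] at hsA hsQ
    have hsub : s ⊆ {x} := by
      intro w hw
      rcases Finset.mem_insert.1 (hsA.1 hw) with h | h
      · simp [h]
      rcases Finset.mem_insert.1 (hsQ.1 hw) with h' | h'
      · simp [h']
      exact absurd h' (Finset.disjoint_left.1 hLU h)
    have := Finset.card_le_card hsub
    rw [Finset.card_singleton] at this
    have := hsA.2.1
    omega
  have hcount : (disconnectedTriangles p G A).card + (disconnectedTriangles p G Q).card + 1 ≤
      (disconnectedTriangles p G S).card := by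
    rw [← Finset.card_union_of_disjoint hdisj,
      ← Finset.card_insert_of_notMem (a := t) (by simp [htA, htQ])]
    exact Finset.card_le_card (Finset.insert_subset htD (Finset.union_subset hmonoA hmonoQ))
  have hDQ : (disconnectedTriangles p G Q).card + 3 ≤ Q.card := by omega
  -- the points up to `y` have a plane graph, on the right of the line from `x` to `y`
  have hpc : PlaneConnects p G (lo y) := ih _ (by omega) (by omega) hy
  have hxlo : x ∈ lo y := Finset.mem_insert_self _ _
  have hylo : y ∈ lo y := by rw [hloy]; exact Finset.mem_insert_self _ _
  have hright : ∀ w ∈ lo y, 1 * orientDet (p x) (p y) (p w) ≤ 0 := by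
    intro w hw
    rw [hloy] at hw
    rcases Finset.mem_insert.1 hw with rfl | hw
    · simp
    rcases Finset.mem_insert.1 hw with rfl | hw
    · simp
    · have := hneg w (hmemL.1 hw).1 y hyT (fun h => hyL (h ▸ hw)) (hmemL.1 hw).2.le
      linarith
  have hxyQ : IsHullEdge p Q 1 x y := by
    refine ⟨Finset.mem_insert_self _ _, Finset.mem_insert_of_mem hyU, (hTx hyT).symm, ?_⟩
    intro w hw hwx hwy
    rcases Finset.mem_insert.1 hw with h | hw
    · exact absurd h hwx
    · rw [one_mul]
      exact hpos y hyT w (hmemU.1 hw).1 (Ne.symm hwy) (hmemU.1 hw).2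
  have := hpc.union_of_hullEdge hp hxyQ hxlo hylo hright hDQ
    fun S' hlt => ih S' (hlt.trans_le (Finset.card_le_card hQS))
  have hall : lo y ∪ Q = S := by
    refine subset_antisymm (Finset.union_subset ?_ hQS) fun w hw => Finset.mem_union.2 ?_
    · rw [hloy]
      exact Finset.insert_subset (hTS hyT) hAS
    · rcases hS_cases hw with rfl | hw | hw
      · exact Or.inl hxlo
      · rw [hloy]
        exact Or.inl (Finset.mem_insert_of_mem (Finset.mem_insert_of_mem hw))
      · exact Or.inr (Finset.mem_insert_of_mem hw)
  rwa [hall] at this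

theorem numDisconnectedEmptyTriangles_eq_card {V : Type*} [Fintype V] (p : V → Plane)
    (G : SimpleGraph V) :
    numDisconnectedEmptyTriangles p G = (disconnectedTriangles p G Finset.univ).card := by
  rw [numDisconnectedEmptyTriangles, ← Set.ncard_coe_finset]
  congr 1
  ext t
  simp [mem_disconnectedTriangles, IsEmptyTriangle, and_assoc]

theorem hasPlaneSpanningTree_of_numDisconnectedEmptyTriangles_le {V : Type*} [Fintype V]
    {p : V → Plane} {G : SimpleGraph V} (hV : 3 ≤ Fintype.card V) (hp : InGeneralPosition p)
    (hs : numDisconnectedEmptyTriangles p G ≤ Fintype.card V - 3) :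
    HasPlaneSpanningTree p G := by
  classical
  have : Nonempty V := Fintype.card_pos_iff.1 (by omega)
  rw [numDisconnectedEmptyTriangles_eq_card] at hs
  exact (planeConnects_of_card_disconnectedTriangles_le hp Finset.univ
    (by rwa [Finset.card_univ]) (by rw [Finset.card_univ]; omega)).hasPlaneSpanningTree

/-! ### The complement of a path on a regular polygon -/

theorem orientDet_regularPolygon {n : ℕ} (hn : n ≠ 0) (i j k : Fin n) :
    orientDet (regularPolygon n i) (regularPolygon n j) (regularPolygon n k) =
      4 * Real.sin (Real.pi * ((j : ℕ) - (i : ℕ)) / n) *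
        Real.sin (Real.pi * ((k : ℕ) - (j : ℕ)) / n) *
        Real.sin (Real.pi * ((k : ℕ) - (i : ℕ)) / n) := by
  have hn' : (n : ℝ) ≠ 0 := Nat.cast_ne_zero.2 hn
  obtain ⟨α, hα⟩ : ∃ α, α = Real.pi * (i : ℕ) / n := ⟨_, rfl⟩
  obtain ⟨β, hβ⟩ : ∃ β, β = Real.pi * (j : ℕ) / n := ⟨_, rfl⟩
  obtain ⟨γ, hγ⟩ : ∃ γ, γ = Real.pi * (k : ℕ) / n := ⟨_, rfl⟩
  have e1 : 2 * Real.pi * (i : ℕ) / n = 2 * α := by rw [hα]; ring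
  have e2 : 2 * Real.pi * (j : ℕ) / n = 2 * β := by rw [hβ]; ring
  have e3 : 2 * Real.pi * (k : ℕ) / n = 2 * γ := by rw [hγ]; ring
  have f1 : Real.pi * ((j : ℕ) - (i : ℕ)) / n = β - α := by rw [hα, hβ]; ring
  have f2 : Real.pi * ((k : ℕ) - (j : ℕ)) / n = γ - β := by rw [hγ, hβ]; ring
  have f3 : Real.pi * ((k : ℕ) - (i : ℕ)) / n = γ - α := by rw [hγ, hα]; ring
  simp only [orientDet, regularPolygon, PiLp.toLp_apply, Matrix.cons_val_zero, Matrix.cons_val_one,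
    e1, e2, e3, f1, f2, f3, Real.sin_sub, Real.sin_two_mul, Real.cos_two_mul]
  have ha := Real.sin_sq_add_cos_sq α
  have hb := Real.sin_sq_add_cos_sq β
  have hc := Real.sin_sq_add_cos_sq γ
  generalize Real.sin α = a at *
  generalize Real.cos α = A at *
  generalize Real.sin β = b at *
  generalize Real.cos β = B at *
  generalize Real.sin γ = c at *
  generalize Real.cos γ = C at *
  have ha' : a ^ 2 = 1 - A ^ 2 := by linarith
  have hb' : b ^ 2 = 1 - B ^ 2 := by linarith
  have hc' : c ^ 2 = 1 - C ^ 2 := by linarith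
  ring_nf
  simp only [ha', hb', hc']
  ring

theorem orientDet_regularPolygon_pos {n : ℕ} {i j k : Fin n} (hij : i < j) (hjk : j < k) :
    0 < orientDet (regularPolygon n i) (regularPolygon n j) (regularPolygon n k) := by
  have hn : 0 < n := i.pos
  have hsin : ∀ {u v : Fin n}, u < v → 0 < Real.sin (Real.pi * ((v : ℕ) - (u : ℕ)) / n) := by
    intro u v huv
    have hn' : (0 : ℝ) < n := Nat.cast_pos.2 hn
    have h1 : ((u : ℕ) : ℝ) < (v : ℕ) := Nat.cast_lt.2 huv
    have h2 : ((v : ℕ) : ℝ) < n := Nat.cast_lt.2 v.isLt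
    have h3 : (0 : ℝ) ≤ (u : ℕ) := Nat.cast_nonneg _
    refine Real.sin_pos_of_pos_of_lt_pi (div_pos (mul_pos Real.pi_pos (by linarith)) hn') ?_
    rw [div_lt_iff₀ hn']
    exact mul_lt_mul_of_pos_left (by linarith) Real.pi_pos
  rw [orientDet_regularPolygon hn.ne']
  have := hsin hij
  have := hsin hjk
  have := hsin (hij.trans hjk)
  positivity

theorem orientDet_regularPolygon_ne_zero {n : ℕ} {i j k : Fin n} (hij : i ≠ j) (hik : i ≠ k)
    (hjk : j ≠ k) :
    orientDet (regularPolygon n i) (regularPolygon n j) (regularPolygon n k) ≠ 0 := by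
  have hn : 0 < n := i.pos
  have hsin : ∀ {u v : Fin n}, u ≠ v → Real.sin (Real.pi * ((v : ℕ) - (u : ℕ)) / n) ≠ 0 := by
    intro u v huv h
    have hn' : (0 : ℝ) < n := Nat.cast_pos.2 hn
    have h1 : ((v : ℕ) : ℝ) < n := Nat.cast_lt.2 v.isLt
    have h2 : ((u : ℕ) : ℝ) < n := Nat.cast_lt.2 u.isLt
    have h3 : (0 : ℝ) ≤ (u : ℕ) := Nat.cast_nonneg _
    have h4 : (0 : ℝ) ≤ (v : ℕ) := Nat.cast_nonneg _
    rw [Real.sin_eq_zero_iff_of_lt_of_lt] at h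
    · rw [div_eq_zero_iff, mul_eq_zero, sub_eq_zero] at h
      rcases h with (h | h) | h
      · exact Real.pi_ne_zero h
      · exact huv (Fin.ext (Nat.cast_injective h)).symm
      · exact hn'.ne' h
    · rw [lt_div_iff₀ hn', neg_mul, ← mul_neg]
      exact mul_lt_mul_of_pos_left (by linarith) Real.pi_pos
    · rw [div_lt_iff₀ hn']
      exact mul_lt_mul_of_pos_left (by linarith) Real.pi_pos
  rw [orientDet_regularPolygon hn.ne']
  exact mul_ne_zero (mul_ne_zero (mul_ne_zero four_ne_zero (hsin hij)) (hsin hjk)) (hsin hik)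

theorem inGeneralPosition_regularPolygon {n : ℕ} (hn : 3 ≤ n) :
    InGeneralPosition (regularPolygon n) := by
  constructor
  · intro i j hij
    by_contra hne
    obtain ⟨k, hk⟩ : ∃ k : Fin n, k ∉ ({i, j} : Finset (Fin n)) := by
      by_contra! hall
      have h1 := Finset.card_le_card (fun k _ => hall k : Finset.univ ⊆ ({i, j} : Finset (Fin n)))
      have h2 := Finset.card_le_two (a := i) (b := j)
      rw [Finset.card_univ, Fintype.card_fin] at h1
      omega
    simp only [Finset.mem_insert, Finset.mem_singleton, not_or] at hk
    apply orientDet_regularPolygon_ne_zero hne (Ne.symm hk.1) (Ne.symm hk.2)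
    rw [hij]
    unfold orientDet; ring
  · intro u v w huv huw hvw h
    exact orientDet_regularPolygon_ne_zero huv huw hvw ((collinear_iff_orientDet_eq_zero _ _ _).1 h)

theorem norm_regularPolygon (n : ℕ) (k : Fin n) : ‖regularPolygon n k‖ = 1 := by
  rw [EuclideanSpace.norm_eq, Fin.sum_univ_two]
  simp [regularPolygon]

/-- All triangles on points of the unit circle are empty, as interior points of their convex hulls
are interior to the disk. -/
theorem regularPolygon_notMem_interior {n : ℕ} (t : Set (Fin n)) (q : Fin n) :
    regularPolygon n q ∉ interior (convexHull ℝ (regularPolygon n '' t)) := by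
  intro h
  have hsub : convexHull ℝ (regularPolygon n '' t) ⊆ Metric.closedBall 0 1 := by
    refine convexHull_min ?_ (convex_closedBall 0 1)
    rintro _ ⟨k, -, rfl⟩
    simp [norm_regularPolygon]
  have h' := interior_mono hsub h
  rw [interior_closedBall _ one_ne_zero] at h'
  simp [norm_regularPolygon] at h'

theorem compl_pathGraph_adj {n : ℕ} {i j : Fin n} :
    (SimpleGraph.pathGraph n)ᶜ.Adj i j ↔
      (i : ℕ) ≠ j ∧ (i : ℕ) + 1 ≠ j ∧ (j : ℕ) + 1 ≠ i := by
  rw [SimpleGraph.compl_adj, SimpleGraph.pathGraph_adj, Ne, Fin.ext_iff]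
  tauto

theorem not_connected_induce_compl_pathGraph_iff {n : ℕ} {i j k : Fin n} (hij : i < j)
    (hjk : j < k) :
    ¬ ((SimpleGraph.pathGraph n)ᶜ.induce (({i, j, k} : Finset (Fin n)) : Set (Fin n))).Connected ↔
      (i : ℕ) + 1 = j ∧ (j : ℕ) + 1 = k := by
  have hij' : (i : ℕ) < j := hij
  have hjk' : (j : ℕ) < k := hjk
  set H := (SimpleGraph.pathGraph n)ᶜ.induce (({i, j, k} : Finset (Fin n)) : Set (Fin n)) with hH
  constructor
  · intro h
    by_contra hcon
    apply h
    let i' : (({i, j, k} : Finset (Fin n)) : Set (Fin n)) := ⟨i, by simp⟩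
    let j' : (({i, j, k} : Finset (Fin n)) : Set (Fin n)) := ⟨j, by simp⟩
    let k' : (({i, j, k} : Finset (Fin n)) : Set (Fin n)) := ⟨k, by simp⟩
    have hik : H.Reachable i' k' := by
      apply SimpleGraph.Adj.reachable
      change (SimpleGraph.pathGraph n)ᶜ.Adj i k
      rw [compl_pathGraph_adj]; omega
    have hji : H.Reachable j' i' := by
      by_cases hc : (i : ℕ) + 1 = j
      · refine SimpleGraph.Reachable.trans (SimpleGraph.Adj.reachable ?_) hik.symm
        change (SimpleGraph.pathGraph n)ᶜ.Adj j k
        rw [compl_pathGraph_adj]; omega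
      · apply SimpleGraph.Adj.reachable
        change (SimpleGraph.pathGraph n)ᶜ.Adj j i
        rw [compl_pathGraph_adj]; omega
    have hto : ∀ u, H.Reachable u i' := by
      rintro ⟨u, hu⟩
      simp only [Finset.coe_insert, Finset.coe_singleton, Set.mem_insert_iff,
        Set.mem_singleton_iff] at hu
      rcases hu with rfl | rfl | rfl
      · exact .rfl
      · exact hji
      · exact hik.symm
    have : Nonempty (({i, j, k} : Finset (Fin n)) : Set (Fin n)) := ⟨i'⟩
    exact { preconnected := fun u v => (hto u).trans (hto v).symm }
  · rintro ⟨h1, h2⟩ hconn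
    have : Nontrivial (({i, j, k} : Finset (Fin n)) : Set (Fin n)) :=
      ⟨⟨⟨i, by simp⟩, ⟨j, by simp⟩, by simpa using hij.ne⟩⟩
    obtain ⟨⟨w, hw⟩, hadj⟩ := hconn.preconnected.exists_adj_of_nontrivial ⟨j, by simp⟩
    have hadj' : (SimpleGraph.pathGraph n)ᶜ.Adj j w := hadj
    rw [compl_pathGraph_adj] at hadj'
    simp only [Finset.coe_insert, Finset.coe_singleton, Set.mem_insert_iff,
      Set.mem_singleton_iff] at hw
    rcases hw with rfl | rfl | rfl <;> omega

theorem exists_lt_lt_of_card_eq_three {α : Type*} [LinearOrder α] {t : Finset α}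
    (ht : t.card = 3) : ∃ i j k, i < j ∧ j < k ∧ t = {i, j, k} := by
  let e := t.orderEmbOfFin ht
  refine ⟨e 0, e 1, e 2, e.strictMono (by decide), e.strictMono (by decide), ?_⟩
  ext a
  have : a ∈ t ↔ ∃ m, e m = a := by
    rw [← Set.mem_range, Finset.range_orderEmbOfFin, Finset.mem_coe]
  rw [this]
  simp [Fin.exists_fin_succ, eq_comm]

theorem numDisconnectedEmptyTriangles_regularPolygon {n : ℕ} (hn : 3 ≤ n) :
    numDisconnectedEmptyTriangles (regularPolygon n) (SimpleGraph.pathGraph n)ᶜ = n - 2 := by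
  let f : Fin (n - 2) → Finset (Fin n) := fun k =>
    {⟨k, by omega⟩, ⟨k + 1, by omega⟩, ⟨k + 2, by omega⟩}
  have hf : Function.Injective f := by
    intro k l hkl
    have h1 : (⟨k, by omega⟩ : Fin n) ∈ f l := by rw [← hkl]; simp [f]
    have h2 : (⟨l, by omega⟩ : Fin n) ∈ f k := by rw [hkl]; simp [f]
    simp only [f, Finset.mem_insert, Finset.mem_singleton, Fin.mk.injEq] at h1 h2
    ext
    omega
  have hset : {t : Finset (Fin n) | IsEmptyTriangle (regularPolygon n) t ∧
      ¬ ((SimpleGraph.pathGraph n)ᶜ.induce (t : Set (Fin n))).Connected} = Set.range f := by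
    ext t
    constructor
    · rintro ⟨⟨hcard, -⟩, hconn⟩
      obtain ⟨i, j, k, hij, hjk, rfl⟩ := exists_lt_lt_of_card_eq_three hcard
      obtain ⟨h1, h2⟩ := (not_connected_induce_compl_pathGraph_iff hij hjk).1 hconn
      refine ⟨⟨i, by omega⟩, ?_⟩
      have e1 : (⟨(i : ℕ) + 1, by omega⟩ : Fin n) = j := Fin.ext h1
      have e2 : (⟨(i : ℕ) + 2, by omega⟩ : Fin n) = k := Fin.ext (by simp; omega)
      simp [f, e1, e2]
    · rintro ⟨k, rfl⟩
      have h1 : (⟨k, by omega⟩ : Fin n) < ⟨k + 1, by omega⟩ := by simp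
      have h2 : (⟨k + 1, by omega⟩ : Fin n) < ⟨k + 2, by omega⟩ := by simp
      refine ⟨⟨?_, fun q => regularPolygon_notMem_interior _ q⟩,
        (not_connected_induce_compl_pathGraph_iff h1 h2).2 ⟨rfl, rfl⟩⟩
      exact Finset.card_eq_three.2 ⟨_, _, _, h1.ne, (h1.trans h2).ne, h2.ne, rfl⟩
  rw [numDisconnectedEmptyTriangles, hset, Set.ncard_range_of_injective hf]
  simp

theorem regularPolygon_segments_cross {n : ℕ} {i j k l : Fin n} (hij : i < j) (hjk : j < k)
    (hkl : k < l) : (segment ℝ (regularPolygon n i) (regularPolygon n k) ∩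
      segment ℝ (regularPolygon n j) (regularPolygon n l)).Nonempty := by
  rw [Set.inter_comm]
  refine exists_mem_segment_inter ?_ ?_ ?_ ?_
  · rw [orientDet_rotate]
    exact orientDet_regularPolygon_pos hij (hjk.trans hkl)
  · rw [orientDet_swap_right]
    exact neg_neg_of_pos (orientDet_regularPolygon_pos hjk hkl)
  · rw [orientDet_swap_right]
    exact neg_neg_of_pos (orientDet_regularPolygon_pos hij hjk)
  · exact orientDet_regularPolygon_pos (hij.trans hjk) hkl

/-- A plane spanning tree would have an edge `ij` of shortest length `j - i ≥ 2`. An edge from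
`i + 1` is shorter if it ends between `i` and `j`, and it crosses `ij` otherwise. -/
theorem not_hasPlaneSpanningTree_regularPolygon {n : ℕ} (hn : 3 ≤ n) :
    ¬ HasPlaneSpanningTree (regularPolygon n) (SimpleGraph.pathGraph n)ᶜ := by
  rintro ⟨T, hT, htree, hplane⟩
  have hinj := (inGeneralPosition_regularPolygon hn).1
  have : Nontrivial (Fin n) := Fin.nontrivial_iff_two_le.2 (by omega)
  have hcross : ∀ {i j k l : Fin n}, i < j → j < k → k < l → T.Adj i k → T.Adj j l → False := by
    intro i j k l hij hjk hkl hik hjl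
    obtain ⟨Z, hZ⟩ := regularPolygon_segments_cross hij hjk hkl
    have hne : s(i, k) ≠ s(j, l) := by
      rw [Ne, Sym2.eq_iff]
      rintro (⟨rfl, -⟩ | ⟨rfl, -⟩)
      · exact lt_irrefl _ hij
      · exact lt_irrefl _ (hij.trans (hjk.trans hkl))
    obtain ⟨hZ₁, hZ₂⟩ := hplane i k j l hik hjl hne hZ
    rcases hZ₁ with rfl | rfl <;> rcases hZ₂ with h | h <;> have := hinj h <;> omega
  obtain ⟨⟨i, j⟩, hij, hmin⟩ :=
    (Set.toFinite {e : Fin n × Fin n | e.1 < e.2 ∧ T.Adj e.1 e.2}).exists_minimalFor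
      (fun e => (e.2 : ℕ) - (e.1 : ℕ)) _ (by
      obtain ⟨w, hw⟩ := htree.1.preconnected.exists_adj_of_nontrivial (⟨0, by omega⟩ : Fin n)
      refine ⟨(⟨0, by omega⟩, w), lt_of_le_of_ne ?_ hw.ne, hw⟩
      exact Fin.le_def.2 (Nat.zero_le _))
  have hmin' : ∀ u v : Fin n, u < v → T.Adj u v → (j : ℕ) - i ≤ (v : ℕ) - u := by
    intro u v huv hadj
    by_contra hlt
    have := hmin (j := (u, v)) ⟨huv, hadj⟩ (by dsimp only; omega)
    dsimp only at this
    omega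
  obtain ⟨hlt, hadj⟩ := hij
  dsimp only at hlt hadj
  have hpath := compl_pathGraph_adj.1 (hT hadj)
  have hlt' : (i : ℕ) < j := hlt
  obtain ⟨m, hm⟩ : ∃ m : Fin n, (m : ℕ) = i + 1 := ⟨⟨i + 1, by omega⟩, rfl⟩
  obtain ⟨w, hw⟩ := htree.1.preconnected.exists_adj_of_nontrivial m
  have hpath' := compl_pathGraph_adj.1 (hT hw)
  have him : i < m := Fin.lt_def.2 (by omega)
  have hmj : m < j := Fin.lt_def.2 (by omega)
  rcases lt_trichotomy w m with hwm | rfl | hwm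
  · have hwi : w < i := Fin.lt_def.2 (by have := Fin.lt_def.1 hwm; omega)
    exact hcross hwi him hmj hw.symm hadj
  · exact hw.ne rfl
  · by_cases hwj : w ≤ j
    · have := hmin' m w hwm hw
      have := Fin.le_def.1 hwj
      omega
    · exact hcross him hmj (not_le.1 hwj) hadj hw

/-! ### The bound and its tightness -/

theorem theorem1 :
    (∀ (V : Type*) [Fintype V] (p : V → Plane) (G : SimpleGraph V),
      3 ≤ Fintype.card V → InGeneralPosition p →
      numDisconnectedEmptyTriangles p G ≤ Fintype.card V - 3 →
      HasPlaneSpanningTree p G) ∧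
    (∀ n : ℕ, 3 ≤ n →
      InGeneralPosition (regularPolygon n) ∧
      numDisconnectedEmptyTriangles (regularPolygon n) (SimpleGraph.pathGraph n)ᶜ = n - 2 ∧
      ¬ HasPlaneSpanningTree (regularPolygon n) (SimpleGraph.pathGraph n)ᶜ) := by
  exact ⟨fun V _ p G hV hp hs =>
      hasPlaneSpanningTree_of_numDisconnectedEmptyTriangles_le hV hp hs,
    fun n hn => ⟨inGeneralPosition_regularPolygon hn,
      numDisconnectedEmptyTriangles_regularPolygon hn,
      not_hasPlaneSpanningTree_regularPolygon hn⟩⟩
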